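/- Let $Y_i=\beta_0+\beta_1D_i+\epsilon_i$ and $D_i=\pi_0+\pi_1Z_i+\eta_i$ ($i=1,2,\dots$) with real coefficients and $\pi_1\neq 0$, where the errors $\epsilon_i,\eta_i$ have finite second moments (and may be correlated with each other), and put $\sigma_\epsilon^2=\operatorname{Var}(\epsilon_1)$. Suppose that one of the following two sampling schemes holds. (a) (Constant instruments) $(Z_i)$ is a deterministic sequence with $\frac1n\sum_{i\le n}(Z_i-\bar Z_n)^2\to 1$, where $\bar Z_n=\frac1n\sum_{i\le n}Z_i$, and the pairs $(\eta_i,\epsilon_i)$ are i.i.d. (b) (Stochastic instruments) The triples $(Z_i,\eta_i,\epsilon_i)$ are i.i.d., $Z_i$ is independent of $\eta_i$ and independent of $\epsilon_i$, $\operatorname{Var}(Z_i)=1$ and $E[Z_i^4]<\infty$. Let $(\lambda_n)$ be real numbers with $\lambda_n/\sqrt n\to\lambda_0$ for some $\lambda_0\ge 0$, and let $$\hat\beta_{\text{ridge}}=\frac{\sum_{i\le n}(Y_i-\bar Y_n)(Z_i-\bar Z_n)}{\sum_{i\le n}(D_i-\bar D_n)(Z_i-\bar Z_n)+\lambda_n}.$$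 Let $\hat\beta_{\text{2SLS}}$ be the same expression with $\lambda_n$ replaced by $0$, and let $V_{\text{ridge}}=\sigma_\epsilon^2/\pi_1^2$. Then, as $n\to\infty$, $$\sqrt n\,(\hat\beta_{\text{ridge}}-\beta_1)\xrightarrow{d}\mathcal N\Big(-\frac{\beta_1\lambda_0}{\pi_1},\,V_{\text{ridge}}\Big)\qquad\text{and}\qquad \sqrt n\,(\hat\beta_{\text{2SLS}}-\beta_1)\xrightarrow{d}\mathcal N(0,V_{\text{ridge}}).$$ Thus the ridge estimator has the same asymptotic variance as 2SLS, with an asymptotic bias proportional to $\lambda_0$. (A normal law of variance $0$ is a point mass. The value assigned to an estimator when its denominator vanishes is immaterial.) -/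

import Mathlib

open MeasureTheory ProbabilityTheory Filter Topology

noncomputable section

/-- The sample mean of the first `n` observations. -/
def sampleMean (x : ℕ → ℝ) (n : ℕ) : ℝ :=
  (∑ i ∈ Finset.range n, x i) / n

/-- The sample covariance of the first `n` observations (normalized by `1 / n`). -/
def sampleCov (x y : ℕ → ℝ) (n : ℕ) : ℝ :=
  (∑ i ∈ Finset.range n, (x i - sampleMean x n) * (y i - sampleMean y n)) / n

/-- The two-stage least squares estimator of the slope, from the first `n` observations of
outcome `Y`, endogenous variable `D` and instrument `Z`. -/
def twoSLS (Y D Z : ℕ → ℝ) (n : ℕ) : ℝ :=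
  (∑ i ∈ Finset.range n, (Y i - sampleMean Y n) * (Z i - sampleMean Z n)) /
    (∑ i ∈ Finset.range n, (D i - sampleMean D n) * (Z i - sampleMean Z n))

/-- The ridge IV estimator with penalty `lam`, from the first `n` observations. -/
def ridgeIV (lam : ℝ) (Y D Z : ℕ → ℝ) (n : ℕ) : ℝ :=
  (∑ i ∈ Finset.range n, (Y i - sampleMean Y n) * (Z i - sampleMean Z n)) /
    ((∑ i ∈ Finset.range n, (D i - sampleMean D n) * (Z i - sampleMean Z n)) + lam)

/-- The ridge IV estimator in terms of sample covariances. -/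
theorem ridgeIV_eq_sampleCov (lam : ℝ) (Y D Z : ℕ → ℝ) {n : ℕ} (hn : n ≠ 0) :
    ridgeIV lam Y D Z n = sampleCov Y Z n / (sampleCov D Z n + lam / n) := by
  have h : (n : ℝ) ≠ 0 := Nat.cast_ne_zero.mpr hn
  unfold ridgeIV sampleCov
  rw [← add_div, div_div_div_cancel_right₀ h]

variable {Ω : Type*} [MeasurableSpace Ω]

/-- The just-identified linear IV model with one instrument:
`Y i = β₀ + β₁ * D i + ε i` and `D i = π₀ + π₁ * Z i + η i`. -/
structure LinearIVModel (β₀ β₁ π₀ π₁ : ℝ) (Y D Z η ε : ℕ → Ω → ℝ) : Prop where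
  structural : ∀ i ω, Y i ω = β₀ + β₁ * D i ω + ε i ω
  first_stage : ∀ i ω, D i ω = π₀ + π₁ * Z i ω + η i ω

/-- Instruments treated as constants: they are a deterministic sequence whose sample variance
tends to `1`, and the error pairs `(η i, ε i)` are i.i.d. with finite second moments
(`η i` and `ε i` may be correlated with each other). -/
structure ConstantInstruments (P : Measure Ω) (Z η ε : ℕ → Ω → ℝ) : Prop where
  instruments : ∃ z : ℕ → ℝ, (∀ i ω, Z i ω = z i) ∧ Tendsto (sampleCov z z) atTop (𝓝 1)
  indep : iIndepFun (fun i ω ↦ (η i ω, ε i ω)) P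
  ident : ∀ i, IdentDistrib (fun ω ↦ (η i ω, ε i ω)) (fun ω ↦ (η 0 ω, ε 0 ω)) P P
  memLp_η : MemLp (η 0) 2 P
  memLp_ε : MemLp (ε 0) 2 P

/-- Stochastic instruments: the triples `(Z i, η i, ε i)` are i.i.d., the instrument is
independent of each of the two errors (which may be correlated with each other), it has unit
variance and a finite fourth moment, and the errors have finite second moments. -/
structure StochasticInstruments (P : Measure Ω) (Z η ε : ℕ → Ω → ℝ) : Prop where
  indep : iIndepFun (fun i ω ↦ (Z i ω, η i ω, ε i ω)) P
  ident : ∀ i, IdentDistrib (fun ω ↦ (Z i ω, η i ω, ε i ω)) (fun ω ↦ (Z 0 ω, η 0 ω, ε 0 ω)) P P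
  exogenous_η : ∀ i, IndepFun (Z i) (η i) P
  exogenous_ε : ∀ i, IndepFun (Z i) (ε i) P
  variance_Z : Var[Z 0; P] = 1
  memLp_Z : MemLp (Z 0) 4 P
  memLp_η : MemLp (η 0) 2 P
  memLp_ε : MemLp (ε 0) 2 P

/-- The asymptotic variance `V_ridge = σ_ε² / π₁²`. -/
def Vridge (P : Measure Ω) (π₁ : ℝ) (ε : ℕ → Ω → ℝ) : ℝ :=
  Var[ε 0; P] / π₁ ^ 2

/-- The random variables `X n` converge in distribution to the normal law `N(m, v)`, `v ≥ 0`. -/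
def TendstoNormal (P : Measure Ω) [IsProbabilityMeasure P] (X : ℕ → Ω → ℝ) (m v : ℝ) : Prop :=
  TendstoInDistribution X atTop (id : ℝ → ℝ) (fun _ ↦ P) (gaussianReal m v.toNNReal)

end

/-! Write `c(x, y)` for `sampleCov x y n`. Substituting the two model equations gives the exact
identity √n(β̂ − β₁) = (√n c(ε, Z) − β₁ λₙ/√n) / (c(D, Z) + λₙ/n) whenever the denominator is
nonzero. Here c(D, Z) = π₁ c(Z, Z) + c(η, Z), so the denominator tends to π₁ in probability; the
numerator tends to N(−β₁λ₀, σ_ε²), and Slutsky's theorem finishes. Since the denominator has a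
constant limit, the joint law of η and ε plays no role.

It remains to prove a central limit theorem for √n c(e, Z), with e equal to ε or η. For constant
instruments this is a weighted i.i.d. sum, handled by `tendstoInDistribution_weighted_sum`; the
weights are negligible because convergence of the sample variances prevents any single observation
from dominating. For stochastic instruments, the products of the deviations from the true means are
i.i.d., and centering at sample means instead costs a term that vanishes in probability. -/

/-! ### Slutsky-type tools. -/

/-- Convergence in distribution to a constant implies convergence in probability. -/
theorem tendstoInMeasure_of_tendstoInDistribution_const {Ω Ω' : Type*} [MeasurableSpace Ω]
    [MeasurableSpace Ω'] {P : Measure Ω} [IsProbabilityMeasure P] {P' : Measure Ω'}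
    [IsProbabilityMeasure P'] {X : ℕ → Ω → ℝ} {c : ℝ}
    (h : TendstoInDistribution X atTop (fun _ : Ω' ↦ c) (fun _ ↦ P) P') :
    TendstoInMeasure P X atTop (fun _ ↦ c) := by
  rw [tendstoInMeasure_iff_norm]
  intro δ hδ
  set F : Set ℝ := {x | δ ≤ ‖x - c‖} with hF
  have hFc : IsClosed F := isClosed_le continuous_const (by fun_prop)
  have hlim := ProbabilityMeasure.limsup_measure_closed_le_of_tendsto h.tendsto hFc
  have h0 : (P'.map (fun _ : Ω' ↦ c)) F = 0 := by
    rw [Measure.map_apply measurable_const hFc.measurableSet]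
    simp [hF, hδ.not_ge]
  have h1 : ∀ n, (P.map (X n)) F = P {x | δ ≤ ‖X n x - c‖} := fun n ↦
    Measure.map_apply_of_aemeasurable (h.forall_aemeasurable n) hFc.measurableSet
  simp only [ProbabilityMeasure.coe_mk, h0, h1] at hlim
  exact tendsto_of_le_liminf_of_limsup_le zero_le hlim

/-- **Slutsky's theorem** for quotients with a nonzero limiting denominator: the value of the
quotient where the denominator vanishes is immaterial. -/
theorem tendstoInDistribution_of_eq_div {Ω Ω' : Type*} [MeasurableSpace Ω] [MeasurableSpace Ω']
    {P : Measure Ω} [IsProbabilityMeasure P] {P' : Measure Ω'} [IsProbabilityMeasure P']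
    {X U W : ℕ → Ω → ℝ} {V : Ω' → ℝ} {c : ℝ} (hc : c ≠ 0)
    (hU : TendstoInDistribution U atTop V (fun _ ↦ P) P')
    (hW : TendstoInMeasure P W atTop (fun _ ↦ c)) (hWm : ∀ n, AEMeasurable (W n) P)
    (hXm : ∀ n, AEMeasurable (X n) P)
    (hX : ∀ᶠ n in atTop, ∀ ω, W n ω ≠ 0 → X n ω = U n ω / W n ω) :
    TendstoInDistribution X atTop (fun ω ↦ V ω / c) (fun _ ↦ P) P' := by
  have hc2 : 0 < c ^ 2 / 4 := by positivity
  have hpos : ∀ w : ℝ, 0 < max (w ^ 2) (c ^ 2 / 4) := fun w ↦ lt_max_of_lt_right hc2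
  -- Truncating the denominator makes the quotient continuous on the whole plane; it equals `x.1 /
  -- x.2` as soon as `|x.2| ≥ |c| / 2`.
  have hg : Continuous (fun x : ℝ × ℝ ↦ x.1 * x.2 / max (x.2 ^ 2) (c ^ 2 / 4)) :=
    Continuous.div (by fun_prop) (by fun_prop) fun x ↦ (hpos x.2).ne'
  have key := hU.continuous_comp_prodMk_of_tendstoInMeasure_const hg hW hWm
  have hlim : (fun ω ↦ V ω * c / max (c ^ 2) (c ^ 2 / 4)) = fun ω ↦ V ω / c := by
    funext ω
    rw [max_eq_left (by linarith)]
    field_simp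
  simp only [hlim] at key
  refine tendstoInDistribution_of_tendstoInMeasure_sub X _ key ?_ hXm
  rw [tendstoInMeasure_iff_norm] at hW ⊢
  intro δ hδ
  have hc' : 0 < |c| / 2 := by positivity
  refine tendsto_of_tendsto_of_tendsto_of_le_of_le' tendsto_const_nhds (hW _ hc')
    (Eventually.of_forall fun n ↦ zero_le) ?_
  filter_upwards [hX] with n hn
  -- `X n` can differ from the truncated quotient only where `W n` is at distance at least `|c| / 2`
  -- from `c`.
  refine measure_mono fun ω hω ↦ ?_
  by_contra hlt
  simp only [Set.mem_ofPred_eq, not_le, Real.norm_eq_abs] at hlt hω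
  have h1 : |c| / 2 < |W n ω| := by
    have := abs_sub_abs_le_abs_sub c (W n ω)
    rw [abs_sub_comm] at this
    linarith
  have hW0 : W n ω ≠ 0 := by
    intro h; rw [h, abs_zero] at h1; linarith
  have h2 : c ^ 2 / 4 ≤ W n ω ^ 2 := by
    rw [← sq_abs c, ← sq_abs (W n ω)]
    nlinarith
  simp only [Pi.sub_apply, Pi.zero_apply, hn ω hW0, max_eq_left h2] at hω
  have h3 : U n ω / W n ω - U n ω * W n ω / W n ω ^ 2 = 0 := by field_simp; ring
  rw [h3] at hω
  simp at hω
  linarith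

/-! ### Central limit theorem for weighted sums. -/

/-- Replace one factor at a time: all remaining factors have norm at most one, so each replacement
costs only its own difference. -/
theorem norm_prod_sub_prod_le_sum_norm_sub {ι R : Type*} [NormedCommRing R] [NormOneClass R]
    (s : Finset ι) (f g : ι → R) (hf : ∀ i ∈ s, ‖f i‖ ≤ 1) (hg : ∀ i ∈ s, ‖g i‖ ≤ 1) :
    ‖∏ i ∈ s, f i - ∏ i ∈ s, g i‖ ≤ ∑ i ∈ s, ‖f i - g i‖ := by
  classical
  induction s using Finset.induction_on with
  | empty => simp
  | insert a s ha ih =>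
    rw [Finset.prod_insert ha, Finset.prod_insert ha, Finset.sum_insert ha]
    have h1 : ‖∏ i ∈ s, f i‖ ≤ 1 := (Finset.norm_prod_le _ _).trans <|
      Finset.prod_le_one (fun _ _ ↦ norm_nonneg _)
        fun i hi ↦ hf i (Finset.mem_insert_of_mem hi)
    have h2 := ih (fun i hi ↦ hf i (Finset.mem_insert_of_mem hi))
      fun i hi ↦ hg i (Finset.mem_insert_of_mem hi)
    have h3 := hg a (Finset.mem_insert_self a s)
    calc ‖f a * ∏ i ∈ s, f i - g a * ∏ i ∈ s, g i‖
        = ‖(f a - g a) * ∏ i ∈ s, f i + g a * (∏ i ∈ s, f i - ∏ i ∈ s, g i)‖ := by ring_nf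
      _ ≤ ‖f a - g a‖ * ‖∏ i ∈ s, f i‖ + ‖g a‖ * ‖∏ i ∈ s, f i - ∏ i ∈ s, g i‖ :=
        (norm_add_le _ _).trans (add_le_add (norm_mul_le _ _) (norm_mul_le _ _))
      _ ≤ ‖f a - g a‖ * 1 + 1 * ∑ i ∈ s, ‖f i - g i‖ := by gcongr
      _ = _ := by ring

/-- Characteristic functions of two square-integrable laws with the same first two moments agree
to second order at `0`. -/
theorem charFun_sub_charFun_isLittleO {μ ν : Measure ℝ} [IsProbabilityMeasure μ]
    [IsProbabilityMeasure ν] (hμ : MemLp id 2 μ) (hν : MemLp id 2 ν)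
    (h1 : ∫ x, x ∂μ = ∫ x, x ∂ν) (h2 : ∫ x, x ^ 2 ∂μ = ∫ x, x ^ 2 ∂ν) :
    (fun t ↦ charFun μ t - charFun ν t) =o[𝓝 0] fun t ↦ t ^ 2 := by
  have key : ∀ {ρ : Measure ℝ} [IsProbabilityMeasure ρ], MemLp id 2 ρ →
      (fun t ↦ charFun ρ t - taylorWithinEval (charFun ρ) 2 Set.univ 0 t) =o[𝓝 0]
        fun t ↦ t ^ 2 := by
    intro ρ _ hρ
    simpa only [sub_zero] using taylor_isLittleO_univ (x₀ := (0 : ℝ)) (n := 2)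
      (contDiff_charFun (n := 2) (by simpa using hρ))
  -- The second-order Taylor polynomial at `0` involves only the moments of order at most two.
  have hEq : ∀ t, taylorWithinEval (charFun μ) 2 Set.univ 0 t =
      taylorWithinEval (charFun ν) 2 Set.univ 0 t := by
    intro t
    rw [taylorWithinEval_charFun_zero (by simpa using hμ),
      taylorWithinEval_charFun_zero (by simpa using hν)]
    simp [Finset.sum_range_succ, h1, h2]
  refine ((key hμ).sub (key hν)).congr_left fun t ↦ ?_
  rw [hEq]; ring

/-- Lindeberg-type central limit theorem for weighted sums of i.i.d. centered square-integrable
random variables with asymptotically negligible weights. -/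
theorem tendstoInDistribution_weighted_sum {Ω : Type*} [MeasurableSpace Ω] {P : Measure Ω}
    [IsProbabilityMeasure P] {X : ℕ → Ω → ℝ} (hX : MemLp (X 0) 2 P) (h0 : P[X 0] = 0)
    (hindep : iIndepFun X P) (hident : ∀ i, IdentDistrib (X i) (X 0) P P) {a : ℕ → ℕ → ℝ}
    (ha : Tendsto (fun n ↦ ∑ i ∈ Finset.range n, a n i ^ 2) atTop (𝓝 1))
    (hmax : ∀ δ > 0, ∀ᶠ n in atTop, ∀ i < n, |a n i| ≤ δ) :
    TendstoInDistribution (fun n ω ↦ ∑ i ∈ Finset.range n, a n i * X i ω) atTop (id : ℝ → ℝ)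
      (fun _ ↦ P) (gaussianReal 0 Var[X 0; P].toNNReal) where
  forall_aemeasurable n :=
    Finset.aemeasurable_fun_sum _ fun i _ ↦ (hident i).aemeasurable_fst.const_mul _
  tendsto := by
    refine ProbabilityMeasure.tendsto_iff_tendsto_charFun.2 fun t ↦ ?_
    simp only [ProbabilityMeasure.coe_mk, Measure.map_id]
    set v := Var[X 0; P].toNNReal with hv
    set μ := P.map (X 0) with hμdef
    have mX := (hident 0).aemeasurable_fst
    have : IsProbabilityMeasure μ := Measure.isProbabilityMeasure_map mX
    have hprod : ∀ n, charFun (P.map (fun ω ↦ ∑ i ∈ Finset.range n, a n i * X i ω)) t =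
        ∏ i ∈ Finset.range n, charFun μ (a n i * t) := by
      intro n
      have hi : iIndepFun (fun i ω ↦ a n i * X i ω) P :=
        hindep.comp (fun i x ↦ a n i * x) (fun i ↦ by fun_prop)
      rw [(hi.restrict _).charFun_map_fun_finsetSum_eq_prod
        (fun i _ ↦ (hident i).aemeasurable_fst.const_mul _)]
      simp only [Finset.prod_apply]
      refine Finset.prod_congr rfl fun i _ ↦ ?_
      rw [charFun_map_mul_comp (hident i).aemeasurable_fst, (hident i).map_eq]
    -- The Gaussian comparison product depends on the weights only through their sum of squares, so
    -- its limit follows by continuity.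
    have hgauss : ∀ n, ∏ i ∈ Finset.range n, charFun (gaussianReal 0 v) (a n i * t) =
        Complex.exp (-(v * t ^ 2 / 2 * (∑ i ∈ Finset.range n, a n i ^ 2 : ℝ))) := by
      intro n
      simp only [charFun_gaussianReal]
      rw [← Complex.exp_sum]
      congr 1
      push_cast
      rw [Finset.mul_sum, ← Finset.sum_neg_distrib]
      exact Finset.sum_congr rfl fun i _ ↦ by ring
    have hlim : Tendsto (fun n ↦ ∏ i ∈ Finset.range n, charFun (gaussianReal 0 v) (a n i * t))
        atTop (𝓝 (charFun (gaussianReal 0 v) t)) := by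
      have h : Continuous fun s : ℝ ↦ Complex.exp (-(v * t ^ 2 / 2 * (s : ℝ))) := by fun_prop
      have h1 : charFun (gaussianReal 0 v) t = Complex.exp (-(v * t ^ 2 / 2 * (1 : ℝ))) := by
        rw [charFun_gaussianReal]
        congr 1
        push_cast
        ring
      simp only [hgauss]
      rw [h1]
      exact (h.tendsto 1).comp ha
    have hoμ : (fun s ↦ charFun μ s - charFun (gaussianReal 0 v) s) =o[𝓝 0] fun s ↦ s ^ 2 := by
      refine charFun_sub_charFun_isLittleO ?_ (memLp_id_gaussianReal 2) ?_ ?_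
      · rw [memLp_map_measure_iff (by fun_prop) mX]
        exact hX
      · rw [integral_id_gaussianReal, hμdef, integral_map mX (by fun_prop)]
        exact h0
      · rw [hμdef, integral_map mX (by fun_prop)]
        have e1 : ∫ x, x ^ 2 ∂gaussianReal 0 v = v := by
          have := variance_id_gaussianReal (μ := 0) (v := v)
          rw [variance_eq_integral (by fun_prop)] at this
          simpa [integral_id_gaussianReal] using this
        rw [e1, hv, Real.coe_toNNReal _ (variance_nonneg _ _), variance_eq_integral mX]
        simp [h0]
    have hdiff : Tendsto (fun n ↦ ∏ i ∈ Finset.range n, charFun μ (a n i * t) -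
        ∏ i ∈ Finset.range n, charFun (gaussianReal 0 v) (a n i * t)) atTop (𝓝 0) := by
      rw [Metric.tendsto_nhds]
      intro δ hδ
      -- The factors differ by at most `κ * t ^ 2 * a n i ^ 2` in total `2 * κ * t ^ 2`, once the
      -- squared weights sum to less than `2`. The added `1` covers `t = 0` and makes the final
      -- inequality strict.
      set κ := δ / (2 * (t ^ 2 + 1)) with hκ
      have hκ0 : 0 < κ := by positivity
      obtain ⟨r, hr, hball⟩ := Metric.eventually_nhds_iff.1 (hoμ.def hκ0)
      have hr' : 0 < r / (|t| + 1) := by positivity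
      filter_upwards [hmax _ (half_pos hr'), ha.eventually (gt_mem_nhds one_lt_two)]
        with n hn hsum
      rw [dist_zero_right]
      have hb : ∀ i ∈ Finset.range n,
          ‖charFun μ (a n i * t) - charFun (gaussianReal 0 v) (a n i * t)‖ ≤
            κ * t ^ 2 * a n i ^ 2 := by
        intro i hi
        have hat : dist (a n i * t) 0 < r := by
          rw [dist_zero_right, norm_mul, Real.norm_eq_abs, Real.norm_eq_abs]
          calc |a n i| * |t| ≤ r / (|t| + 1) / 2 * |t| := by
                gcongr; exact hn i (Finset.mem_range.1 hi)
            _ ≤ r / (|t| + 1) / 2 * (|t| + 1) := by gcongr; linarith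
            _ = r / 2 := by field_simp
            _ < r := by linarith
        refine (hball hat).trans_eq ?_
        rw [Real.norm_eq_abs, abs_of_nonneg (sq_nonneg _)]
        ring
      calc _ ≤ ∑ i ∈ Finset.range n,
            ‖charFun μ (a n i * t) - charFun (gaussianReal 0 v) (a n i * t)‖ :=
            norm_prod_sub_prod_le_sum_norm_sub _ _ _ (fun _ _ ↦ norm_charFun_le_one _)
              fun _ _ ↦ norm_charFun_le_one _
        _ ≤ ∑ i ∈ Finset.range n, κ * t ^ 2 * a n i ^ 2 := Finset.sum_le_sum hb
        _ = κ * t ^ 2 * ∑ i ∈ Finset.range n, a n i ^ 2 := by rw [Finset.mul_sum]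
        _ ≤ κ * t ^ 2 * 2 := by gcongr
        _ < κ * (t ^ 2 + 1) * 2 := by
          have : κ * t ^ 2 < κ * (t ^ 2 + 1) := by gcongr; linarith
          linarith
        _ = δ := by rw [hκ]; field_simp
    simp only [hprod]
    simpa using hdiff.add hlim

/-! ### Algebra of sample covariances. -/

theorem sum_sub_sampleMean (x : ℕ → ℝ) (n : ℕ) :
    ∑ i ∈ Finset.range n, (x i - sampleMean x n) = 0 := by
  rcases eq_or_ne n 0 with rfl | hn
  · simp
  · have h : (n : ℝ) ≠ 0 := Nat.cast_ne_zero.mpr hn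
    rw [Finset.sum_sub_distrib, Finset.sum_const, Finset.card_range, nsmul_eq_mul, sampleMean]
    field_simp
    ring

/-- Centering of the first argument of a sample covariance is immaterial. -/
theorem sampleCov_eq_sum_sub_mul (x y : ℕ → ℝ) (c : ℝ) (n : ℕ) :
    sampleCov x y n = (∑ i ∈ Finset.range n, (x i - c) * (y i - sampleMean y n)) / n := by
  have h : ∑ i ∈ Finset.range n, (x i - sampleMean x n) * (y i - sampleMean y n) =
      ∑ i ∈ Finset.range n, (x i - c) * (y i - sampleMean y n) -
        (sampleMean x n - c) * ∑ i ∈ Finset.range n, (y i - sampleMean y n) := by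
    rw [Finset.mul_sum, ← Finset.sum_sub_distrib]
    exact Finset.sum_congr rfl fun i _ ↦ by ring
  rw [sampleCov, h, sum_sub_sampleMean, mul_zero, sub_zero]

/-- Deviations of `y` from its mean sum to zero, so constants drop out. This serves both the
structural and the first-stage equation. -/
theorem sampleCov_add_mul_add (a b : ℝ) (x u y : ℕ → ℝ) (n : ℕ) :
    sampleCov (fun i ↦ a + b * x i + u i) y n = b * sampleCov x y n + sampleCov u y n := by
  rw [sampleCov_eq_sum_sub_mul _ y a, sampleCov_eq_sum_sub_mul x y 0,
    sampleCov_eq_sum_sub_mul u y 0, mul_div_assoc', ← add_div, Finset.mul_sum,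
    ← Finset.sum_add_distrib]
  congr 1
  exact Finset.sum_congr rfl fun i _ ↦ by ring

theorem sum_sub_mul_sub_eq (x y : ℕ → ℝ) (c d : ℝ) (n : ℕ) :
    ∑ i ∈ Finset.range n, (x i - c) * (y i - d) =
      ∑ i ∈ Finset.range n, (x i - sampleMean x n) * (y i - sampleMean y n) +
        n * ((sampleMean x n - c) * (sampleMean y n - d)) := by
  have h : ∑ i ∈ Finset.range n, (x i - c) * (y i - d) =
      ∑ i ∈ Finset.range n, (x i - sampleMean x n) * (y i - sampleMean y n) +
        (sampleMean x n - c) * ∑ i ∈ Finset.range n, (y i - sampleMean y n) +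
        (sampleMean y n - d) * ∑ i ∈ Finset.range n, (x i - sampleMean x n) +
        ∑ i ∈ Finset.range n, (sampleMean x n - c) * (sampleMean y n - d) := by
    simp only [Finset.mul_sum, ← Finset.sum_add_distrib]
    exact Finset.sum_congr rfl fun i _ ↦ by ring
  rw [h, sum_sub_sampleMean, sum_sub_sampleMean]
  simp

/-- The sample covariance about arbitrary centers. -/
theorem sampleCov_eq_sub (x y : ℕ → ℝ) (c d : ℝ) {n : ℕ} (hn : n ≠ 0) :
    sampleCov x y n = (∑ i ∈ Finset.range n, (x i - c) * (y i - d)) / n -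
      (sampleMean x n - c) * (sampleMean y n - d) := by
  have h : (n : ℝ) ≠ 0 := Nat.cast_ne_zero.mpr hn
  rw [sum_sub_mul_sub_eq, sampleCov, add_div, mul_div_cancel_left₀ _ h, add_sub_cancel_right]

/-! ### Negligibility of deterministic instrument weights. -/

/-- The centered sum of squares of the first `n` observations. -/
noncomputable def sumSq (z : ℕ → ℝ) (n : ℕ) : ℝ :=
  ∑ i ∈ Finset.range n, (z i - sampleMean z n) ^ 2

theorem sampleCov_self (z : ℕ → ℝ) (n : ℕ) : sampleCov z z n = sumSq z n / n := by
  simp only [sampleCov, sumSq, sq]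

theorem sum_sub_sq_eq (z : ℕ → ℝ) (c : ℝ) (n : ℕ) :
    ∑ i ∈ Finset.range n, (z i - c) ^ 2 = sumSq z n + n * (sampleMean z n - c) ^ 2 := by
  simpa only [sq, sumSq] using sum_sub_mul_sub_eq z z c c n

theorem sumSq_nonneg (z : ℕ → ℝ) (n : ℕ) : 0 ≤ sumSq z n :=
  Finset.sum_nonneg fun _ _ ↦ sq_nonneg _

/-- About the mean of all `n` points, the first `k` squares alone already contain this term. It
controls the drift of the sample mean. -/
theorem mul_sq_sampleMean_sub_le (z : ℕ → ℝ) {k n : ℕ} (hkn : k ≤ n) :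
    k * (sampleMean z k - sampleMean z n) ^ 2 ≤ sumSq z n := by
  have h1 := sum_sub_sq_eq z (sampleMean z n) k
  have h2 : ∑ i ∈ Finset.range k, (z i - sampleMean z n) ^ 2 ≤ sumSq z n :=
    Finset.sum_le_sum_of_subset_of_nonneg (Finset.range_mono hkn) fun _ _ _ ↦ sq_nonneg _
  linarith [sumSq_nonneg z k]

/-- Recentering the first `n` points at the new mean can only increase their sum of squares. -/
theorem sq_sub_sampleMean_succ_le (z : ℕ → ℝ) (n : ℕ) :
    (z n - sampleMean z (n + 1)) ^ 2 ≤ sumSq z (n + 1) - sumSq z n := by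
  have h1 := sum_sub_sq_eq z (sampleMean z (n + 1)) n
  have h2 : sumSq z (n + 1) = ∑ i ∈ Finset.range n, (z i - sampleMean z (n + 1)) ^ 2 +
      (z n - sampleMean z (n + 1)) ^ 2 := Finset.sum_range_succ _ _
  have h3 : 0 ≤ n * (sampleMean z n - sampleMean z (n + 1)) ^ 2 := by positivity
  linarith

theorem tendsto_succ_div_of_tendsto_div {u : ℕ → ℝ} {c : ℝ}
    (h : Tendsto (fun n ↦ u n / n) atTop (𝓝 c)) :
    Tendsto (fun n ↦ u (n + 1) / n) atTop (𝓝 c) := by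
  have h1 : Tendsto (fun n : ℕ ↦ ((n : ℝ) + 1) / n) atTop (𝓝 1) := by
    have := (tendsto_one_div_atTop_nhds_zero_nat (𝕜 := ℝ)).const_add 1
    rw [add_zero] at this
    refine this.congr' ?_
    filter_upwards [eventually_ne_atTop 0] with n hn
    have : (n : ℝ) ≠ 0 := Nat.cast_ne_zero.mpr hn
    field_simp
  have h2 := ((tendsto_add_atTop_iff_nat 1).2 h).mul h1
  rw [mul_one] at h2
  refine h2.congr fun n ↦ ?_
  have : (n : ℝ) + 1 ≠ 0 := by positivity
  push_cast
  field_simp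

/-- Late indices satisfy `u i / n ≤ u i / i`; the finitely many early ones are crushed by `1 / n`.
-/
theorem eventually_forall_lt_div_le {u : ℕ → ℝ} (hu : ∀ n, 0 ≤ u n)
    (h : Tendsto (fun n ↦ u n / n) atTop (𝓝 0)) {δ : ℝ} (hδ : 0 < δ) :
    ∀ᶠ n : ℕ in atTop, ∀ i < n, u i / n ≤ δ := by
  obtain ⟨N, hN⟩ := eventually_atTop.1 ((h.eventually (gt_mem_nhds hδ)).and (eventually_ne_atTop 0))
  filter_upwards [(tendsto_const_div_atTop_nhds_zero_nat
    (∑ i ∈ Finset.range N, u i)).eventually (gt_mem_nhds hδ)] with n hn i hi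
  have hn0 : (0 : ℝ) < n := Nat.cast_pos.2 (by omega)
  rcases lt_or_ge i N with hiN | hiN
  · refine le_trans ?_ hn.le
    gcongr
    exact Finset.single_le_sum (fun j _ ↦ hu j) (Finset.mem_range.2 hiN)
  · refine le_trans ?_ (hN i hiN).1.le
    have : (0 : ℝ) < i := Nat.cast_pos.2 (Nat.pos_of_ne_zero (hN i hiN).2)
    have hu' := hu i
    gcongr

/-- The sample means need not be bounded, but relative to the mean at a fixed large `k` they drift
by at most √(C n / k), for large `n`. -/
theorem tendsto_sq_sampleMean_div {z : ℕ → ℝ} {c : ℝ}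
    (h : Tendsto (sampleCov z z) atTop (𝓝 c)) :
    Tendsto (fun n ↦ sampleMean z n ^ 2 / n) atTop (𝓝 0) := by
  rw [Metric.tendsto_nhds]
  intro δ hδ
  set C := |c| + 1 with hC
  have hC0 : 0 < C := by positivity
  obtain ⟨k, hk⟩ := exists_nat_gt (4 * C / δ)
  have hk0 : (0 : ℝ) < k := lt_trans (by positivity) hk
  have hcC : c < C := by rw [hC]; linarith [le_abs_self c]
  filter_upwards [h.eventually (gt_mem_nhds hcC), eventually_ge_atTop k,
    (tendsto_const_div_atTop_nhds_zero_nat (2 * sampleMean z k ^ 2)).eventually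
      (gt_mem_nhds (half_pos hδ)), eventually_gt_atTop 0] with n h1 h2 h3 h4
  have hn : (0 : ℝ) < n := Nat.cast_pos.2 h4
  rw [dist_zero_right, Real.norm_eq_abs, abs_of_nonneg (by positivity)]
  rw [sampleCov_self, div_lt_iff₀ hn] at h1
  have h5 := mul_sq_sampleMean_sub_le z h2
  rw [div_lt_iff₀ hδ] at hk
  have h6 : k * (sampleMean z k - sampleMean z n) ^ 2 < k * (δ / 4 * n) := by nlinarith
  have h7 := lt_of_mul_lt_mul_left h6 hk0.le
  rw [div_lt_iff₀ hn] at h3 ⊢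
  -- With `a`, `b` the means at `n` and `k`, this is `a ^ 2 ≤ 2 * (a - b) ^ 2 + 2 * b ^ 2`; each
  -- summand is below `δ / 2 * n`.
  nlinarith [sq_nonneg (2 * sampleMean z k - sampleMean z n)]

/-- If the sample variances converge, then the normalized deviations from the sample mean are
uniformly negligible. -/
theorem eventually_forall_abs_sub_sampleMean_div_sqrt_le {z : ℕ → ℝ} {c : ℝ}
    (h : Tendsto (sampleCov z z) atTop (𝓝 c)) {δ : ℝ} (hδ : 0 < δ) :
    ∀ᶠ n : ℕ in atTop, ∀ i < n, |(z i - sampleMean z n) / √n| ≤ δ := by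
  have hS : Tendsto (fun n ↦ sumSq z n / n) atTop (𝓝 c) := h.congr (sampleCov_self z)
  have hm := tendsto_sq_sampleMean_div h
  -- The squared deviation of the newest point is at most an increment of `sumSq`, which is o(n)
  -- because `sumSq z n / n` converges.
  have hz : Tendsto (fun n ↦ z n ^ 2 / n) atTop (𝓝 0) := by
    have h1 := (((tendsto_succ_div_of_tendsto_div hS).sub hS).const_mul 2).add
      ((tendsto_succ_div_of_tendsto_div hm).const_mul 2)
    simp only [sub_self, mul_zero, add_zero] at h1
    refine squeeze_zero (fun n ↦ by positivity) (fun n ↦ ?_) h1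
    have h2 := sq_sub_sampleMean_succ_le z n
    have h3 : z n ^ 2 ≤
        2 * (sumSq z (n + 1) - sumSq z n) + 2 * sampleMean z (n + 1) ^ 2 := by
      nlinarith [sq_nonneg (z n - 2 * sampleMean z (n + 1))]
    calc z n ^ 2 / n
        ≤ (2 * (sumSq z (n + 1) - sumSq z n) + 2 * sampleMean z (n + 1) ^ 2) / n := by gcongr
      _ = _ := by ring
  have hδ4 : 0 < δ ^ 2 / 4 := by positivity
  filter_upwards [eventually_forall_lt_div_le (fun n ↦ sq_nonneg (z n)) hz hδ4,
    hm.eventually (gt_mem_nhds hδ4)] with n h1 h2 i hi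
  have hn : (0 : ℝ) < n := Nat.cast_pos.2 (by omega)
  have h3 := h1 i hi
  refine abs_le_of_sq_le_sq ?_ hδ.le
  rw [div_pow, Real.sq_sqrt hn.le]
  rw [div_le_iff₀ hn] at h3 ⊢
  rw [div_lt_iff₀ hn] at h2
  nlinarith [sq_nonneg (z i + sampleMean z n)]

/-! ### Measurability and convergence in probability. -/

section Tools

variable {Ω Ω' : Type*} [MeasurableSpace Ω] [MeasurableSpace Ω'] {P : Measure Ω}

theorem aemeasurable_sampleMean {X : ℕ → Ω → ℝ} (hX : ∀ i, AEMeasurable (X i) P) (n : ℕ) :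
    AEMeasurable (fun ω ↦ sampleMean (fun i ↦ X i ω) n) P :=
  (Finset.aemeasurable_fun_sum _ fun i _ ↦ hX i).div_const _

theorem aemeasurable_sum_sub_mul_sub {X Y : ℕ → Ω → ℝ} (hX : ∀ i, AEMeasurable (X i) P)
    (hY : ∀ i, AEMeasurable (Y i) P) (n : ℕ) :
    AEMeasurable (fun ω ↦ ∑ i ∈ Finset.range n, (X i ω - sampleMean (fun i ↦ X i ω) n) *
      (Y i ω - sampleMean (fun i ↦ Y i ω) n)) P :=
  Finset.aemeasurable_fun_sum _ fun i _ ↦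
    ((hX i).sub (aemeasurable_sampleMean hX n)).mul ((hY i).sub (aemeasurable_sampleMean hY n))

theorem aemeasurable_sampleCov {X Y : ℕ → Ω → ℝ} (hX : ∀ i, AEMeasurable (X i) P)
    (hY : ∀ i, AEMeasurable (Y i) P) (n : ℕ) :
    AEMeasurable (fun ω ↦ sampleCov (fun i ↦ X i ω) (fun i ↦ Y i ω) n) P :=
  (aemeasurable_sum_sub_mul_sub hX hY n).div_const _

theorem aemeasurable_ridgeIV {Y D Z : ℕ → Ω → ℝ} (hY : ∀ i, AEMeasurable (Y i) P)
    (hD : ∀ i, AEMeasurable (D i) P) (hZ : ∀ i, AEMeasurable (Z i) P) (l : ℝ) (n : ℕ) :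
    AEMeasurable (fun ω ↦ ridgeIV l (fun i ↦ Y i ω) (fun i ↦ D i ω) (fun i ↦ Z i ω) n) P :=
  (aemeasurable_sum_sub_mul_sub hY hZ n).div ((aemeasurable_sum_sub_mul_sub hD hZ n).add_const _)

theorem tendsto_sampleMean_ae {X : ℕ → Ω → ℝ} (hint : Integrable (X 0) P) (hindep : iIndepFun X P)
    (hident : ∀ i, IdentDistrib (X i) (X 0) P P) :
    ∀ᵐ ω ∂P, Tendsto (fun n ↦ sampleMean (fun i ↦ X i ω) n) atTop (𝓝 P[X 0]) :=
  strong_law_ae_real X hint (fun _ _ hij ↦ hindep.indepFun hij) hident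

variable [IsProbabilityMeasure P] {P' : Measure Ω'} [IsProbabilityMeasure P']

theorem tendstoInMeasure_of_tendsto {u : ℕ → ℝ} {c : ℝ} (h : Tendsto u atTop (𝓝 c)) :
    TendstoInMeasure P (fun n _ ↦ u n) atTop (fun _ ↦ c) :=
  tendstoInMeasure_of_tendsto_ae (fun _ ↦ aestronglyMeasurable_const)
    (Eventually.of_forall fun _ ↦ h)

theorem tendstoInMeasure_add_const {X Y : ℕ → Ω → ℝ} {a b : ℝ}
    (hX : TendstoInMeasure P X atTop (fun _ ↦ a)) (hY : TendstoInMeasure P Y atTop (fun _ ↦ b))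
    (hXm : ∀ n, AEMeasurable (X n) P) (hYm : ∀ n, AEMeasurable (Y n) P) :
    TendstoInMeasure P (fun n ω ↦ X n ω + Y n ω) atTop (fun _ ↦ a + b) :=
  tendstoInMeasure_of_tendstoInDistribution_const
    ((hX.tendstoInDistribution hXm).add_of_tendstoInMeasure_const hY hYm)

/-- A sequence converging in distribution times a sequence converging to `0` in probability
converges to `0` in probability. -/
theorem tendstoInMeasure_mul_zero {X Y : ℕ → Ω → ℝ} {V : Ω' → ℝ}
    (hX : TendstoInDistribution X atTop V (fun _ ↦ P) P')
    (hY : TendstoInMeasure P Y atTop (fun _ ↦ 0)) (hYm : ∀ n, AEMeasurable (Y n) P) :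
    TendstoInMeasure P (fun n ω ↦ X n ω * Y n ω) atTop (fun _ ↦ 0) := by
  have h := hX.continuous_comp_prodMk_of_tendstoInMeasure_const
    (g := fun x : ℝ × ℝ ↦ x.1 * x.2) (by fun_prop) hY hYm
  simp only [mul_zero] at h
  exact tendstoInMeasure_of_tendstoInDistribution_const h

/-- Multiply by the null sequence `1 / √n`. Thus the central limit theorem for the covariance of `η`
and `Z` also supplies its consistency. -/
theorem tendstoInMeasure_zero_of_sqrt_mul {X : ℕ → Ω → ℝ} {V : Ω' → ℝ}
    (h : TendstoInDistribution (fun (n : ℕ) ω ↦ √(n : ℝ) * X n ω) atTop V (fun _ ↦ P) P') :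
    TendstoInMeasure P X atTop (fun _ ↦ 0) := by
  have h0 : Tendsto (fun n : ℕ ↦ (√(n : ℝ))⁻¹) atTop (𝓝 0) :=
    tendsto_inv_atTop_zero.comp (Real.tendsto_sqrt_atTop.comp tendsto_natCast_atTop_atTop)
  refine (tendstoInMeasure_mul_zero h (tendstoInMeasure_of_tendsto h0)
    fun _ ↦ aemeasurable_const).congr' ?_ EventuallyEq.rfl
  filter_upwards [eventually_gt_atTop 0] with n hn
  have : √(n : ℝ) ≠ 0 := (Real.sqrt_pos.2 (Nat.cast_pos.2 hn)).ne'
  exact Eventually.of_forall fun ω ↦ by field_simp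

/-- Only the law of the limit matters, so its carrier space may be exchanged for the Gaussian one.
-/
theorem tendstoNormal_of_map_eq {X : ℕ → Ω → ℝ} {V : Ω' → ℝ} {m v : ℝ}
    (h : TendstoInDistribution X atTop V (fun _ ↦ P) P')
    (hV : P'.map V = gaussianReal m v.toNNReal) : TendstoNormal P X m v where
  forall_aemeasurable := h.forall_aemeasurable
  tendsto := by
    have h' := h.tendsto
    rw! [hV] at h'
    rw! [Measure.map_id]
    exact h'

end Tools

/-! ### Limits of sample covariances under the two sampling schemes. -/

section Sampling

variable {Ω : Type*} [MeasurableSpace Ω] {P : Measure Ω} [IsProbabilityMeasure P]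

theorem sqrt_mul_div_self (n : ℕ) (x : ℝ) : √(n : ℝ) * (x / n) = (√(n : ℝ))⁻¹ * x := by
  rw [mul_div_assoc', mul_comm, mul_div_assoc, Real.sqrt_div_self', mul_comm, one_div]

/-- Asymptotic normality of the sample covariance of i.i.d. errors with a deterministic sequence
of instruments. -/
theorem tendstoNormal_sqrt_mul_sampleCov_of_const {e : ℕ → Ω → ℝ} (he : MemLp (e 0) 2 P)
    (hindep : iIndepFun e P) (hident : ∀ i, IdentDistrib (e i) (e 0) P P) {z : ℕ → ℝ}
    (hz : Tendsto (sampleCov z z) atTop (𝓝 1)) :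
    TendstoNormal P (fun n ω ↦ √(n : ℝ) * sampleCov (fun i ↦ e i ω) z n) 0 Var[e 0; P] := by
  set m := P[e 0] with hm
  have hident' : ∀ i, IdentDistrib (fun ω ↦ e i ω - m) (fun ω ↦ e 0 ω - m) P P := fun i ↦
    (hident i).comp (u := fun x ↦ x - m) (by fun_prop)
  have h0 : P[fun ω ↦ e 0 ω - m] = 0 := by
    rw [integral_sub (he.integrable one_le_two) (by simp)]
    simp [hm]
  have key := tendstoInDistribution_weighted_sum (X := fun i ω ↦ e i ω - m)
    (a := fun n i ↦ (z i - sampleMean z n) / √n) (he.sub (memLp_const m)) h0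
    (hindep.comp (fun _ x ↦ x - m) fun _ ↦ by fun_prop) hident'
    (hz.congr fun n ↦ by
      rw [sampleCov_self, sumSq, Finset.sum_div]
      exact Finset.sum_congr rfl fun i _ ↦ by rw [div_pow, Real.sq_sqrt n.cast_nonneg])
    fun δ hδ ↦ eventually_forall_abs_sub_sampleMean_div_sqrt_le hz hδ
  rw [variance_sub_const he.aestronglyMeasurable] at key
  have heq : (fun (n : ℕ) ω ↦ √(n : ℝ) * sampleCov (fun i ↦ e i ω) z n) =
      fun n ω ↦ ∑ i ∈ Finset.range n, (z i - sampleMean z n) / √n * (e i ω - m) := by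
    funext n ω
    rw [sampleCov_eq_sum_sub_mul _ _ m, sqrt_mul_div_self, Finset.mul_sum]
    exact Finset.sum_congr rfl fun i _ ↦ by ring
  rw [TendstoNormal, heq]
  exact key

/-- Asymptotic normality of the sample covariance of i.i.d. errors with i.i.d. instruments of
unit variance that are independent of the errors. -/
theorem tendstoNormal_sqrt_mul_sampleCov_of_indep {e Z : ℕ → Ω → ℝ} (he : MemLp (e 0) 2 P)
    (hZ : MemLp (Z 0) 2 P) (hindep : iIndepFun (fun i ω ↦ (Z i ω, e i ω)) P)
    (hident : ∀ i, IdentDistrib (fun ω ↦ (Z i ω, e i ω)) (fun ω ↦ (Z 0 ω, e 0 ω)) P P)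
    (hexo : IndepFun (Z 0) (e 0) P) (hvar : Var[Z 0; P] = 1) :
    TendstoNormal P (fun n ω ↦ √(n : ℝ) * sampleCov (fun i ↦ e i ω) (fun i ↦ Z i ω) n) 0
      Var[e 0; P] := by
  set m := P[e 0] with hm
  set μ := P[Z 0] with hμ
  have hidZ : ∀ i, IdentDistrib (Z i) (Z 0) P P := fun i ↦ (hident i).comp measurable_fst
  have hide : ∀ i, IdentDistrib (e i) (e 0) P P := fun i ↦ (hident i).comp measurable_snd
  have hinZ : iIndepFun Z P := hindep.comp (fun _ x ↦ x.1) fun _ ↦ measurable_fst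
  have hine : iIndepFun e P := hindep.comp (fun _ x ↦ x.2) fun _ ↦ measurable_snd
  have hZm := fun i ↦ (hidZ i).aemeasurable_fst
  have hem := fun i ↦ (hide i).aemeasurable_fst
  set X : ℕ → Ω → ℝ := fun i ω ↦ (e i ω - m) * (Z i ω - μ) with hX
  have hXident : ∀ i, IdentDistrib (X i) (X 0) P P := fun i ↦
    (hident i).comp (u := fun x : ℝ × ℝ ↦ (x.2 - m) * (x.1 - μ)) (by fun_prop)
  have hXindep : iIndepFun X P :=
    hindep.comp (fun _ x ↦ (x.2 - m) * (x.1 - μ)) fun _ ↦ by fun_prop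
  have he' : MemLp (fun ω ↦ e 0 ω - m) 2 P := he.sub (memLp_const m)
  have hZ' : MemLp (fun ω ↦ Z 0 ω - μ) 2 P := hZ.sub (memLp_const μ)
  have hind' : IndepFun (fun ω ↦ e 0 ω - m) (fun ω ↦ Z 0 ω - μ) P :=
    hexo.symm.comp (φ := fun x ↦ x - m) (ψ := fun x ↦ x - μ) (by fun_prop) (by fun_prop)
  have hindsq : IndepFun (fun ω ↦ (e 0 ω - m) ^ 2) (fun ω ↦ (Z 0 ω - μ) ^ 2) P :=
    hexo.symm.comp (φ := fun x ↦ (x - m) ^ 2) (ψ := fun x ↦ (x - μ) ^ 2) (by fun_prop)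
      (by fun_prop)
  -- Independence is what puts the product in L²: its square is a product of independent integrable
  -- variables.
  have hXL : MemLp (X 0) 2 P := by
    rw [memLp_two_iff_integrable_sq (hXident 0).aemeasurable_fst.aestronglyMeasurable]
    simp only [hX, mul_pow]
    exact hindsq.integrable_mul he'.integrable_sq hZ'.integrable_sq
  have hX0 : P[X 0] = 0 := by
    have : P[X 0] = P[fun ω ↦ e 0 ω - m] * P[fun ω ↦ Z 0 ω - μ] :=
      hind'.integral_fun_mul_eq_mul_integral he'.aestronglyMeasurable hZ'.aestronglyMeasurable
    rw [this, integral_sub (he.integrable one_le_two) (by simp)]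
    simp [hm]
  have hXv : Var[X 0; P] = Var[e 0; P] := by
    rw [variance_of_integral_eq_zero (hXident 0).aemeasurable_fst hX0]
    have : ∫ ω, X 0 ω ^ 2 ∂P = (∫ ω, (e 0 ω - m) ^ 2 ∂P) * ∫ ω, (Z 0 ω - μ) ^ 2 ∂P := by
      simp only [hX, mul_pow]
      exact hindsq.integral_fun_mul_eq_mul_integral he'.integrable_sq.aestronglyMeasurable
        hZ'.integrable_sq.aestronglyMeasurable
    rw [this, ← variance_eq_integral (hZm 0), hvar, mul_one, ← variance_eq_integral (hem 0)]
  have hA := tendstoInDistribution_inv_sqrt_mul_sum_sub (Y := (id : ℝ → ℝ))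
    (HasLaw.id) hXL hXindep hXident
  have hB := tendstoInDistribution_inv_sqrt_mul_sum_sub (Y := (id : ℝ → ℝ))
    (HasLaw.id) hZ hinZ hidZ
  have hC : TendstoInMeasure P (fun n ω ↦ -(sampleMean (fun i ↦ e i ω) n - m)) atTop
      (fun _ ↦ 0) := by
    refine tendstoInMeasure_of_tendsto_ae (fun n ↦
      ((aemeasurable_sampleMean hem n).sub_const m).neg.aestronglyMeasurable) ?_
    filter_upwards [tendsto_sampleMean_ae (he.integrable one_le_two) hine hide] with ω hω
    have h := (hω.sub_const m).neg
    rwa [← hm, sub_self, neg_zero] at h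
  -- The cost of centering at sample means, √n (Z̄ − μ)(ē − m), is a convergent-in-law factor times
  -- one that vanishes in probability.
  have hBC := tendstoInMeasure_mul_zero hB hC
    fun n ↦ ((aemeasurable_sampleMean hem n).sub_const m).neg
  have key := hA.add_of_tendstoInMeasure_const hBC fun n ↦ (hB.forall_aemeasurable n).mul
    ((aemeasurable_sampleMean hem n).sub_const m).neg
  rw [hXv] at key
  have heq : (fun (n : ℕ) ω ↦ √(n : ℝ) * sampleCov (fun i ↦ e i ω) (fun i ↦ Z i ω) n) =
      (fun (n : ℕ) ω ↦ (√(n : ℝ))⁻¹ * (∑ k ∈ Finset.range n, X k ω - n * P[X 0])) +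
      fun (n : ℕ) ω ↦ (√(n : ℝ))⁻¹ * (∑ k ∈ Finset.range n, Z k ω - n * P[Z 0]) *
        -(sampleMean (fun i ↦ e i ω) n - m) := by
    funext n ω
    rcases eq_or_ne n 0 with rfl | hn
    · simp
    have hn' : (n : ℝ) ≠ 0 := Nat.cast_ne_zero.mpr hn
    have hs : ∑ k ∈ Finset.range n, Z k ω - n * μ = n * (sampleMean (fun i ↦ Z i ω) n - μ) := by
      rw [sampleMean]; field_simp
    simp only [Pi.add_apply]
    rw [sampleCov_eq_sub _ _ m μ hn, hX0, ← hμ, hs, mul_sub, sqrt_mul_div_self, mul_zero, sub_zero,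
      sub_eq_add_neg]
    congr 1
    have : √(n : ℝ) = (√(n : ℝ))⁻¹ * n := by
      rw [← div_eq_inv_mul, Real.div_sqrt]
    conv_lhs => rw [this]
    ring
  rw [TendstoNormal, heq]
  have hid : (fun x : ℝ ↦ id x + 0) = id := by funext x; simp
  rw [hid] at key
  exact key

/-- Consistency of the sample variance. -/
theorem tendstoInMeasure_sampleCov_self {Z : ℕ → Ω → ℝ} (hZ : MemLp (Z 0) 2 P)
    (hindep : iIndepFun Z P) (hident : ∀ i, IdentDistrib (Z i) (Z 0) P P) :
    TendstoInMeasure P (fun n ω ↦ sampleCov (fun i ↦ Z i ω) (fun i ↦ Z i ω) n) atTop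
      (fun _ ↦ Var[Z 0; P]) := by
  have hZm := fun i ↦ (hident i).aemeasurable_fst
  refine tendstoInMeasure_of_tendsto_ae
    (fun n ↦ (aemeasurable_sampleCov hZm hZm n).aestronglyMeasurable) ?_
  have h2 : ∀ᵐ ω ∂P, Tendsto (fun n ↦ sampleMean (fun i ↦ Z i ω ^ 2) n) atTop
      (𝓝 (∫ ω, Z 0 ω ^ 2 ∂P)) :=
    tendsto_sampleMean_ae (X := fun i ω ↦ Z i ω ^ 2) hZ.integrable_sq
      (hindep.comp (fun _ x ↦ x ^ 2) fun _ ↦ by fun_prop)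
      fun i ↦ (hident i).comp (u := fun x ↦ x ^ 2) (by fun_prop)
  filter_upwards [tendsto_sampleMean_ae (hZ.integrable one_le_two) hindep hident, h2] with ω h1 h2
  have hv : Var[Z 0; P] = ∫ ω, Z 0 ω ^ 2 ∂P - P[Z 0] ^ 2 := variance_eq_sub hZ
  rw [hv]
  refine (h2.sub (h1.pow 2)).congr' ?_
  filter_upwards [eventually_ne_atTop 0] with n hn
  rw [sampleCov_eq_sub _ _ 0 0 hn, sub_zero, ← sq]
  simp only [sampleMean, sub_zero, sq]

end Sampling

/-! ### The ridge estimator and the main theorem. -/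

theorem ridgeIV_zero (Y D Z : ℕ → ℝ) (n : ℕ) : ridgeIV 0 Y D Z n = twoSLS Y D Z n := by
  rw [ridgeIV, twoSLS, add_zero]

theorem gaussianReal_map_add_const_div_const (v a c : ℝ) (hv : 0 ≤ v) :
    (gaussianReal 0 v.toNNReal).map (fun x ↦ (x + a) / c) =
      gaussianReal (a / c) (v / c ^ 2).toNNReal := by
  have h : (fun x : ℝ ↦ (x + a) / c) = (fun x ↦ x / c) ∘ fun x ↦ x + a := rfl
  rw [h, ← Measure.map_map (by fun_prop) (by fun_prop), gaussianReal_map_add_const,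
    gaussianReal_map_div_const, zero_add]
  congr 1
  ext
  rw [NNReal.coe_div, Real.coe_toNNReal _ hv, Real.coe_toNNReal _ (by positivity)]
  simp

/-- Asymptotic normality of the ridge estimator, from the limits of the sample covariances. -/
theorem tendstoNormal_ridgeIV {Ω : Type*} [MeasurableSpace Ω] {P : Measure Ω}
    [IsProbabilityMeasure P] {β₀ β₁ π₀ π₁ : ℝ} (hπ₁ : π₁ ≠ 0) {Y D Z η ε : ℕ → Ω → ℝ}
    (hmodel : LinearIVModel β₀ β₁ π₀ π₁ Y D Z η ε)
    (hZ : ∀ i, AEMeasurable (Z i) P) (hη : ∀ i, AEMeasurable (η i) P)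
    (hε : ∀ i, AEMeasurable (ε i) P) {vη vε : ℝ} (hvε : 0 ≤ vε)
    (hcη : TendstoNormal P
      (fun n ω ↦ √(n : ℝ) * sampleCov (fun i ↦ η i ω) (fun i ↦ Z i ω) n) 0 vη)
    (hcε : TendstoNormal P
      (fun n ω ↦ √(n : ℝ) * sampleCov (fun i ↦ ε i ω) (fun i ↦ Z i ω) n) 0 vε)
    (hcZ : TendstoInMeasure P (fun n ω ↦ sampleCov (fun i ↦ Z i ω) (fun i ↦ Z i ω) n) atTop
      (fun _ ↦ 1))
    {lam : ℕ → ℝ} {lam₀ : ℝ} (hlam : Tendsto (fun n : ℕ ↦ lam n / √(n : ℝ)) atTop (𝓝 lam₀)) :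
    TendstoNormal P
      (fun n ω ↦ √(n : ℝ) *
        (ridgeIV (lam n) (fun i ↦ Y i ω) (fun i ↦ D i ω) (fun i ↦ Z i ω) n - β₁))
      (-(β₁ * lam₀ / π₁)) (vε / π₁ ^ 2) := by
  have hDeq : ∀ i, D i = fun ω ↦ π₀ + π₁ * Z i ω + η i ω := fun i ↦
    funext (hmodel.first_stage i)
  have hYeq : ∀ i, Y i = fun ω ↦ β₀ + β₁ * D i ω + ε i ω := fun i ↦ funext (hmodel.structural i)
  have hD : ∀ i, AEMeasurable (D i) P := fun i ↦ by
    rw [hDeq]; exact (((hZ i).const_mul _).const_add _).add (hη i)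
  have hY : ∀ i, AEMeasurable (Y i) P := fun i ↦ by
    rw [hYeq]; exact (((hD i).const_mul _).const_add _).add (hε i)
  have hcovD : ∀ n ω, sampleCov (fun i ↦ D i ω) (fun i ↦ Z i ω) n =
      π₁ * sampleCov (fun i ↦ Z i ω) (fun i ↦ Z i ω) n +
        sampleCov (fun i ↦ η i ω) (fun i ↦ Z i ω) n := fun n ω ↦ by
    simp only [hmodel.first_stage]; exact sampleCov_add_mul_add _ _ _ _ _ _
  have hcovY : ∀ n ω, sampleCov (fun i ↦ Y i ω) (fun i ↦ Z i ω) n =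
      β₁ * sampleCov (fun i ↦ D i ω) (fun i ↦ Z i ω) n +
        sampleCov (fun i ↦ ε i ω) (fun i ↦ Z i ω) n := fun n ω ↦ by
    simp only [hmodel.structural]; exact sampleCov_add_mul_add _ _ _ _ _ _
  have hZZm := aemeasurable_sampleCov hZ hZ
  have hηZm := aemeasurable_sampleCov hη hZ
  have hinv : Tendsto (fun n : ℕ ↦ (√(n : ℝ))⁻¹) atTop (𝓝 0) :=
    tendsto_inv_atTop_zero.comp (Real.tendsto_sqrt_atTop.comp tendsto_natCast_atTop_atTop)
  have hlamn : Tendsto (fun n : ℕ ↦ lam n / n) atTop (𝓝 0) := by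
    have h := hlam.mul hinv
    rw [mul_zero] at h
    refine h.congr fun n ↦ ?_
    rw [← div_eq_mul_inv, div_div, Real.mul_self_sqrt n.cast_nonneg]
  have hW : TendstoInMeasure P
      (fun n ω ↦ sampleCov (fun i ↦ D i ω) (fun i ↦ Z i ω) n + lam n / n) atTop (fun _ ↦ π₁) := by
    have h1 : TendstoInDistribution
        (fun n ω ↦ π₁ * sampleCov (fun i ↦ Z i ω) (fun i ↦ Z i ω) n) atTop
        (fun _ : Ω ↦ π₁ * 1) (fun _ ↦ P) P :=
      (hcZ.tendstoInDistribution hZZm).continuous_comp (g := fun x ↦ π₁ * x) (by fun_prop)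
    have h2 := tendstoInMeasure_add_const
      (tendstoInMeasure_add_const (tendstoInMeasure_of_tendstoInDistribution_const h1)
        (tendstoInMeasure_zero_of_sqrt_mul hcη) (fun n ↦ (hZZm n).const_mul _) hηZm)
      (tendstoInMeasure_of_tendsto hlamn) (fun n ↦ ((hZZm n).const_mul _).add (hηZm n))
      fun _ ↦ aemeasurable_const
    simpa only [hcovD, mul_one, add_zero] using h2
  have hU := TendstoInDistribution.add_of_tendstoInMeasure_const hcε
    (tendstoInMeasure_of_tendsto ((hlam.const_mul β₁).neg)) fun _ ↦ aemeasurable_const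
  have key := tendstoInDistribution_of_eq_div
    (X := fun n ω ↦ √(n : ℝ) *
      (ridgeIV (lam n) (fun i ↦ Y i ω) (fun i ↦ D i ω) (fun i ↦ Z i ω) n - β₁))
    hπ₁ hU hW (fun n ↦ (aemeasurable_sampleCov hD hZ n).add_const _)
    (fun n ↦ ((aemeasurable_ridgeIV hY hD hZ _ n).sub_const _).const_mul _) ?_
  · refine tendstoNormal_of_map_eq key ?_
    rw [← neg_div]
    exact gaussianReal_map_add_const_div_const _ _ _ hvε
  -- The exact identity for √n(β̂ − β₁): multiplying by the denominator cancels `β₁ * sampleCov D Z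
  -- n` and leaves the penalty term `-β₁ * lam n / √n`.
  · filter_upwards [eventually_ne_atTop 0] with n hn ω hω
    have hs : √(n : ℝ) ≠ 0 := (Real.sqrt_pos.2 (Nat.cast_pos.2 (Nat.pos_of_ne_zero hn))).ne'
    have hl : √(n : ℝ) * (lam n / n) = lam n / √n := by
      rw [sqrt_mul_div_self, div_eq_inv_mul]
    rw [ridgeIV_eq_sampleCov _ _ _ _ hn, hcovY, eq_div_iff hω, mul_assoc, sub_mul,
      div_mul_cancel₀ _ hω]
    simp only [Pi.add_apply]
    rw [← hl]
    ring

theorem mainTheorem4 {Ω : Type*} [MeasurableSpace Ω] (P : Measure Ω) [IsProbabilityMeasure P]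
    (β₀ β₁ π₀ π₁ : ℝ) (hπ₁ : π₁ ≠ 0)
    (Y D Z η ε : ℕ → Ω → ℝ)
    (hmodel : LinearIVModel β₀ β₁ π₀ π₁ Y D Z η ε)
    (hsampling : ConstantInstruments P Z η ε ∨ StochasticInstruments P Z η ε)
    (lam : ℕ → ℝ) (lam₀ : ℝ) (hlam₀ : 0 ≤ lam₀)
    (hlam : Tendsto (fun n : ℕ ↦ lam n / √(n : ℝ)) atTop (𝓝 lam₀)) :
    TendstoNormal P
      (fun n ω ↦ √(n : ℝ) *
        (ridgeIV (lam n) (fun i ↦ Y i ω) (fun i ↦ D i ω) (fun i ↦ Z i ω) n - β₁))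
      (-(β₁ * lam₀ / π₁)) (Vridge P π₁ ε) ∧
    TendstoNormal P
      (fun n ω ↦ √(n : ℝ) *
        (twoSLS (fun i ↦ Y i ω) (fun i ↦ D i ω) (fun i ↦ Z i ω) n - β₁))
      0 (Vridge P π₁ ε) := by
  -- Generalizing over the penalty sequence lets 2SLS be the case of zero penalty.
  suffices h : ∀ (l : ℕ → ℝ) (l₀ : ℝ), Tendsto (fun n : ℕ ↦ l n / √(n : ℝ)) atTop (𝓝 l₀) →
      TendstoNormal P
        (fun n ω ↦ √(n : ℝ) *
          (ridgeIV (l n) (fun i ↦ Y i ω) (fun i ↦ D i ω) (fun i ↦ Z i ω) n - β₁))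
        (-(β₁ * l₀ / π₁)) (Vridge P π₁ ε) by
    refine ⟨h lam lam₀ hlam, ?_⟩
    simpa [ridgeIV_zero] using h (fun _ ↦ 0) 0 (by simp)
  intro l l₀ hl
  rcases hsampling with h | h
  · obtain ⟨z, hz, hzlim⟩ := h.instruments
    have hidη : ∀ i, IdentDistrib (η i) (η 0) P P := fun i ↦ (h.ident i).comp measurable_fst
    have hidε : ∀ i, IdentDistrib (ε i) (ε 0) P P := fun i ↦ (h.ident i).comp measurable_snd
    have hZm : ∀ i, AEMeasurable (Z i) P := fun i ↦ by
      rw [show Z i = fun _ ↦ z i from funext (hz i)]; exact aemeasurable_const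
    refine tendstoNormal_ridgeIV hπ₁ hmodel hZm (fun i ↦ (hidη i).aemeasurable_fst)
      (fun i ↦ (hidε i).aemeasurable_fst) (variance_nonneg _ _) (vη := Var[η 0; P]) ?_ ?_ ?_ hl
    · simp only [hz]
      exact tendstoNormal_sqrt_mul_sampleCov_of_const h.memLp_η
        (h.indep.comp (fun _ x ↦ x.1) fun _ ↦ measurable_fst) hidη hzlim
    · simp only [hz]
      exact tendstoNormal_sqrt_mul_sampleCov_of_const h.memLp_ε
        (h.indep.comp (fun _ x ↦ x.2) fun _ ↦ measurable_snd) hidε hzlim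
    · simp only [hz]
      exact tendstoInMeasure_of_tendsto hzlim
  · have hidZ : ∀ i, IdentDistrib (Z i) (Z 0) P P := fun i ↦ (h.ident i).comp measurable_fst
    have hidη : ∀ i, IdentDistrib (fun ω ↦ (Z i ω, η i ω)) (fun ω ↦ (Z 0 ω, η 0 ω)) P P := fun i ↦
      (h.ident i).comp (u := fun x : ℝ × ℝ × ℝ ↦ (x.1, x.2.1)) (by fun_prop)
    have hidε : ∀ i, IdentDistrib (fun ω ↦ (Z i ω, ε i ω)) (fun ω ↦ (Z 0 ω, ε 0 ω)) P P := fun i ↦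
      (h.ident i).comp (u := fun x : ℝ × ℝ × ℝ ↦ (x.1, x.2.2)) (by fun_prop)
    have hZ2 : MemLp (Z 0) 2 P := h.memLp_Z.mono_exponent (by norm_num)
    refine tendstoNormal_ridgeIV hπ₁ hmodel (fun i ↦ (hidZ i).aemeasurable_fst)
      (fun i ↦ ((hidη i).comp measurable_snd).aemeasurable_fst)
      (fun i ↦ ((hidε i).comp measurable_snd).aemeasurable_fst) (variance_nonneg _ _)
      (vη := Var[η 0; P]) ?_ ?_ ?_ hl
    · exact tendstoNormal_sqrt_mul_sampleCov_of_indep h.memLp_η hZ2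
        (h.indep.comp (fun _ x ↦ (x.1, x.2.1)) fun _ ↦ by fun_prop) hidη (h.exogenous_η 0)
        h.variance_Z
    · exact tendstoNormal_sqrt_mul_sampleCov_of_indep h.memLp_ε hZ2
        (h.indep.comp (fun _ x ↦ (x.1, x.2.2)) fun _ ↦ by fun_prop) hidε (h.exogenous_ε 0)
        h.variance_Z
    · rw [← h.variance_Z]
      exact tendstoInMeasure_sampleCov_self hZ2
        (h.indep.comp (fun _ x ↦ x.1) fun _ ↦ by fun_prop) hidZ
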